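/- Setting. Let $\Omega_1,\dots,\Omega_J$ be pairwise disjoint open subsets of $[-1/2,1/2)^2$, let $\boldsymbol\alpha_j=(\alpha_{j1},\alpha_{j2})\in\mathbb C^2$, $\beta_j\in\mathbb C$, and let $$u(\boldsymbol x)=\sum_{j=1}^J(\boldsymbol\alpha_j^T\boldsymbol x+\beta_j)1_{\Omega_j}(\boldsymbol x),\qquad p(\boldsymbol x)=(p_1,p_2)(\boldsymbol x)=\sum_{j=1}^J\boldsymbol\alpha_j1_{\Omega_j}(\boldsymbol x),\qquad \boldsymbol x\in\mathbb R^2,$$ with singularity set $\Gamma=\bigcup_{j=1}^J\partial\Omega_j$. Let $\nabla u$ and $\nabla_s p=\frac12(\nabla p+\nabla p^T)$ be the gradient and the symmetric gradient in the sense of tempered distributions, and let $\mathscr F$ be the Fourier transform with kernel $e^{-2\pi i\boldsymbol\xi\cdot\boldsymbol x}$, applied to each of the two components of $\nabla u-p$ and to each of the four components of $\nabla_sp$. A trigonometric polynomial is a function $\varphi(\boldsymbol x)=\sum_{\boldsymbol k}\boldsymbol a(\boldsymbol k)e^{-2\pi i\boldsymbol k\cdot\boldsymbol x}$ with finitely many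 nonzero coefficients $\boldsymbol a(\boldsymbol k)\in\mathbb C$, $\boldsymbol k\in\mathbb Z^2$; its degree is the pair $(\max|k_1|,\max|k_2|)$ over the $\boldsymbol k$ with $\boldsymbol a(\boldsymbol k)\neq0$. Let $\varphi$ be a minimal polynomial of $\Gamma$, that is, $\varphi$ is not identically zero, $\Gamma\subseteq\{\varphi=0\}$, and no nonzero trigonometric polynomial vanishing on $\Gamma$ has a degree that is componentwise at most, and different from, that of $\varphi$. Let $\mathbb K=\{-n_1,\dots,n_1\}\times\{-n_2,\dots,n_2\}$ be a rectangular grid, symmetric about the origin, that contains the support of the coefficients $\boldsymbol a$ of $\varphi$, and let $\mathbb K'\subset\mathbb Z^2$ be a finite set strictly containing $\mathbb K$. For finite $A,B\subset\mathbb Z^2$ write $A:B=\{\boldsymbol k\in A:\boldsymbol k+\boldsymbol m\in A\text{ for all }\boldsymbol m\in B\}$. Let $N\in\mathbb N$ and $\mathbb O=\{-\lfloor N/2\rfloor,\dots,\lfloor (N-1)/2\rfloor\}^2$. For $\boldsymbol q=(\boldsymbol q_1,\dots,\boldsymbol q_r)$ with $\boldsymbol q_c:\mathbb O\to\mathbb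 C$, the multi-fold Hankel matrix $\boldsymbol{\mathcal H}\boldsymbol q$ with filter support $\mathbb K'$ is obtained by stacking on top of each other the matrices $(\boldsymbol q_c(\boldsymbol k+\boldsymbol m))_{\boldsymbol k\in\mathbb O:\mathbb K',\,\boldsymbol m\in\mathbb K'}$, $c=1,\dots,r$; it has $|\mathbb K'|$ columns. Claim. The Fourier transforms $\mathscr F(\nabla u-p)$ and $\mathscr F(\nabla_sp)$ are (componentwise) continuous functions on $\mathbb R^2$, and the multi-fold Hankel matrices built from their samples on $\mathbb O$ satisfy $$\operatorname{rank}\Big(\boldsymbol{\mathcal H}\big(\mathscr F(\nabla u-p)|_{\mathbb O}\big)\Big)\le|\mathbb K'|-|\mathbb K':\mathbb K|,\qquad \operatorname{rank}\Big(\boldsymbol{\mathcal H}\big(\mathscr F(\nabla_sp)|_{\mathbb O}\big)\Big)\le|\mathbb K'|-|\mathbb K':\mathbb K|.$$ In particular both matrices are rank deficient: each rank is strictly smaller than the number $|\mathbb K'|$ of columns, so each matrix has a nontrivial null space. -/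

import Mathlib

open MeasureTheory
open scoped SchwartzMap FourierTransform LineDeriv ContDiff

noncomputable section

namespace HankelSLRM

/-- The Euclidean plane `ℝ²`. -/
abbrev Plane : Type := EuclideanSpace ℝ (Fin 2)

/-- Two dimensional integer multi-indices. -/
abbrev Idx : Type := Fin 2 → ℤ

/-- A multi-index `k ∈ ℤ²` seen as a point (frequency) of the plane. -/
def toPlane (k : Idx) : Plane := WithLp.toLp 2 fun i => (k i : ℝ)

/-! ### Grids -/

/-- The sampling grid `𝕆 = {-⌊N/2⌋, …, ⌊(N-1)/2⌋}²` (the division of integers rounds down). -/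
def sampleGrid (N : ℕ) : Finset Idx :=
  Fintype.piFinset fun _ => Finset.Icc (-((N : ℤ) / 2)) (((N : ℤ) - 1) / 2)

/-- The finite rectangular grid `{-n₁, …, n₁} × {-n₂, …, n₂}`, symmetric about the origin. -/
def symGrid (n : Fin 2 → ℕ) : Finset Idx :=
  Fintype.piFinset fun i => Finset.Icc (-(n i : ℤ)) (n i : ℤ)

/-- `A : B = {k ∈ A : k + m ∈ A for all m ∈ B}`. -/
def colon (A B : Finset Idx) : Finset Idx :=
  A.filter fun k => ∀ m ∈ B, k + m ∈ A

theorem add_mem_of_mem_colon {A B : Finset Idx} {k m : Idx} (hk : k ∈ colon A B) (hm : m ∈ B) :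
    k + m ∈ A :=
  (Finset.mem_filter.mp hk).2 m hm

/-! ### Hankel matrices -/

/-- The multi-fold Hankel matrix with filter support `K`, built from the components `v c`, `c ∈ ι`,
of a tensor valued function on the grid `O`: the Hankel matrices `(𝓗 (v c)) (k, m) = v c (k + m)`,
`k ∈ O : K`, `m ∈ K`, of the components are stacked on top of each other. -/
def multiHankel {ι : Type} (O K : Finset Idx) (v : ι → O → ℂ) :
    Matrix (ι × colon O K) K ℂ :=
  Matrix.of fun r m => v r.1 ⟨r.2.1 + m.1, add_mem_of_mem_colon r.2.2 m.2⟩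

/-! ### Trigonometric polynomials -/

/-- The trigonometric polynomial `φ(x) = ∑ₖ a(k) exp(-2πi k · x)` with coefficients `a`. -/
def trigPoly (a : Idx →₀ ℂ) (x : Plane) : ℂ :=
  a.sum fun k c => c * Complex.exp (-2 * Real.pi * Complex.I * ∑ i, (k i : ℂ) * (x i : ℂ))

/-- The degree (in each of the two coordinates) of a trigonometric polynomial: the half-widths of
the smallest symmetric rectangular grid that supports its coefficients. -/
def trigDegree (a : Idx →₀ ℂ) : Fin 2 → ℕ :=
  fun i => a.support.sup fun k => (k i).natAbs

/-- The coefficients `a` define a nonzero trigonometric polynomial that vanishes on `Γ`. -/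
def VanishesOn (Γ : Set Plane) (a : Idx →₀ ℂ) : Prop :=
  a ≠ 0 ∧ Γ ⊆ {x | trigPoly a x = 0}

/-- The coefficients `a` define a minimal polynomial of `Γ`: a nonzero trigonometric polynomial
vanishing on `Γ` such that no other one has smaller degree (in the componentwise order). -/
def IsMinimalPoly (Γ : Set Plane) (a : Idx →₀ ℂ) : Prop :=
  VanishesOn Γ a ∧ ∀ b, VanishesOn Γ b → ¬ trigDegree b < trigDegree a

/-! ### Piecewise linear images -/

/-- The data of a piecewise linear image `u = ∑ⱼ (αⱼᵀ x + βⱼ) 1_{Ωⱼ}`, where the `Ωⱼ` are pairwise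
disjoint open subsets of `[-1/2, 1/2)²`. -/
structure PiecewiseLinear (J : ℕ) where
  /-- the pieces -/
  Ω : Fin J → Set Plane
  /-- the slopes -/
  α : Fin J → Fin 2 → ℂ
  /-- the offsets -/
  β : Fin J → ℂ
  isOpen : ∀ j, IsOpen (Ω j)
  subset_box : ∀ j, ∀ x ∈ Ω j, ∀ i, x i ∈ Set.Ico (-(1 / 2) : ℝ) (1 / 2)
  disjoint : Pairwise fun j l => Disjoint (Ω j) (Ω l)

namespace PiecewiseLinear

variable {J : ℕ} (D : PiecewiseLinear J)

/-- The image `u(x) = ∑ⱼ (αⱼᵀ x + βⱼ) 1_{Ωⱼ}(x)`. -/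
def u (x : Plane) : ℂ :=
  ∑ j, (D.Ω j).indicator (fun x => (∑ i, D.α j i * (x i : ℂ)) + D.β j) x

/-- The piecewise constant vector field `p = ∑ⱼ αⱼ 1_{Ωⱼ}`. -/
def p (i : Fin 2) (x : Plane) : ℂ :=
  ∑ j, (D.Ω j).indicator (fun _ => D.α j i) x

/-- The singularity set `Γ = ⋃ⱼ ∂Ωⱼ`. -/
def singSet : Set Plane := ⋃ j, frontier (D.Ω j)

theorem isBounded (j : Fin J) : Bornology.IsBounded (D.Ω j) := by
  refine (Metric.isBounded_closedBall (x := (0 : Plane)) (r := 1)).subset fun x hx => ?_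
  have h0 := D.subset_box j x hx 0
  have h1 := D.subset_box j x hx 1
  rw [Set.mem_Ico] at h0 h1
  rw [mem_closedBall_zero_iff, EuclideanSpace.norm_eq, Real.sqrt_le_iff, Fin.sum_univ_two]
  simp only [Real.norm_eq_abs, sq_abs]
  refine ⟨zero_le_one, ?_⟩
  nlinarith

theorem memLp_indicator (j : Fin J) {f : Plane → ℂ} (hf : Continuous f) :
    MemLp ((D.Ω j).indicator f) 1 (volume : Measure Plane) := by
  rw [memLp_one_iff_integrable, integrable_indicator_iff (D.isOpen j).measurableSet]
  exact (hf.continuousOn.integrableOn_compact (D.isBounded j).isCompact_closure).mono_set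
    subset_closure

theorem memLp_u : MemLp D.u 1 (volume : Measure Plane) := by
  refine memLp_finsetSum _ fun j _ => D.memLp_indicator j ?_
  fun_prop

theorem memLp_p (i : Fin 2) : MemLp (D.p i) 1 (volume : Measure Plane) :=
  memLp_finsetSum _ fun j _ => D.memLp_indicator j continuous_const

/-- `u` as a tempered distribution. -/
def uDist : 𝓢'(Plane, ℂ) := (D.memLp_u.toLp D.u : Lp ℂ 1 (volume : Measure Plane))

/-- The components of `p` as tempered distributions. -/
def pDist (i : Fin 2) : 𝓢'(Plane, ℂ) :=
  ((D.memLp_p i).toLp (D.p i) : Lp ℂ 1 (volume : Measure Plane))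

end PiecewiseLinear

/-- The distributional partial derivative `∂ᵢ T`. -/
def partialD (i : Fin 2) (T : 𝓢'(Plane, ℂ)) : 𝓢'(Plane, ℂ) :=
  ∂_{(EuclideanSpace.single i (1 : ℝ) : Plane)} T

/-- The residual `∇u - p`, as a vector of two tempered distributions. -/
def gradResidual {J : ℕ} (D : PiecewiseLinear J) (i : Fin 2) : 𝓢'(Plane, ℂ) :=
  partialD i D.uDist - D.pDist i

/-- The symmetric gradient `∇ₛp = (∇p + ∇pᵀ) / 2`, as a matrix of four tempered distributions. -/
def symGrad {J : ℕ} (D : PiecewiseLinear J) (c : Fin 2 × Fin 2) : 𝓢'(Plane, ℂ) :=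
  (1 / 2 : ℂ) • (partialD c.2 (D.pDist c.1) + partialD c.1 (D.pDist c.2))

/-! ### Pointwise values of a Fourier transform -/

/-- The Fourier transform of the tempered distribution `T` is the continuous function `g`. There is
at most one such `g`, so that its values are the samples of the Fourier transform of `T`. -/
def IsFourierFun (T : 𝓢'(Plane, ℂ)) (g : Plane → ℂ) : Prop :=
  Continuous g ∧ ∀ f : 𝓢(Plane, ℂ), Integrable (fun ξ => f ξ * g ξ) ∧ 𝓕 T f = ∫ ξ, f ξ * g ξ

theorem IsFourierFun.unique {T : 𝓢'(Plane, ℂ)} {g h : Plane → ℂ} (hg : IsFourierFun T g)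
    (hh : IsFourierFun T h) : g = h := by
  refine (hg.1.ae_eq_iff_eq (volume : Measure Plane) hh.1).mp ?_
  refine ae_eq_of_integral_contDiff_smul_eq hg.1.locallyIntegrable hh.1.locallyIntegrable ?_
  intro f hf hc
  have hc' : HasCompactSupport (Complex.ofRealCLM ∘ f) := hc.comp_left rfl
  have hf' : ContDiff ℝ ∞ (Complex.ofRealCLM ∘ f) := by fun_prop
  have h1 := (hg.2 (hc'.toSchwartzMap hf')).2
  have h2 := (hh.2 (hc'.toSchwartzMap hf')).2
  simpa using h1.symm.trans h2

/-- The samples on the grid `O` of a tensor valued function on the frequency plane. -/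
def samples {ι : Type} (O : Finset Idx) (g : ι → Plane → ℂ) : ι → O → ℂ :=
  fun c k => g c (toPlane k.1)

end HankelSLRM

end

open HankelSLRM

noncomputable section

/-! ### Integrals of derivatives of functions vanishing on the boundary -/

section Boundary

variable {E F : Type*} [NormedAddCommGroup E] [NormedSpace ℝ E] [NormedAddCommGroup F]

/-! Let `f` be the affine (or constant) function on a piece `Ω`. Since `φ` vanishes on the frontier
of `Ω`, the integral over `Ω` of `∂ᵢ(φ · wave ξ · f)` is zero. Multiplication by `φ` superposes
frequency shifts, so expanding this integral gives a convolution relation between the coefficients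
`a` and the Fourier transforms of the residuals (`annihilates_of_frontier_subset`). No regularity of
the frontier is needed, because an extension by zero is Lipschitz (`setIntegral_fderiv_eq_zero`).
Every translate of `a` that stays supported in `K'` is then in the kernel of the Hankel matrix.
These translates are indexed by `colon K' K` and are independent because the group algebra of `ℤ²`
is a domain; rank-nullity concludes (`rank_multiHankel_add_card_colon_le`). -/

theorem LipschitzOnWith.lipschitzWith_indicator {s Ω : Set E} {g : E → F}
    {C : NNReal}
    (hg : LipschitzOnWith C g s) (hs : closure Ω ⊆ s) (h0 : ∀ x ∈ frontier Ω, g x = 0) :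
    LipschitzWith C (Ω.indicator g) := by
  have key : ∀ x ∈ Ω, ∀ y ∉ Ω, dist (g x) 0 ≤ C * dist x y := by
    intro x hx y hy
    -- Otherwise the interior and the exterior of `Ω` would disconnect the segment.
    obtain ⟨z, hz, hzΩ⟩ : (segment ℝ x y ∩ frontier Ω).Nonempty := by
      by_contra hne
      have hfr : ∀ z ∈ segment ℝ x y, z ∈ closure Ω → z ∈ interior Ω := fun z hz hzc => by
        by_contra hzi
        exact hne ⟨z, hz, hzc, hzi⟩
      obtain ⟨z, -, hz1, hz2⟩ := (convex_segment x y).isPreconnected (interior Ω) (closure Ω)ᶜ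
        isOpen_interior isClosed_closure.isOpen_compl
        (fun z hz => (em (z ∈ closure Ω)).imp (hfr z hz) id)
        ⟨x, left_mem_segment ℝ x y, hfr x (left_mem_segment ℝ x y) (subset_closure hx)⟩
        ⟨y, right_mem_segment ℝ x y,
          fun h => hy (interior_subset (hfr y (right_mem_segment ℝ x y) h))⟩
      exact hz2 (subset_closure (interior_subset hz1))
    rw [← h0 z hzΩ]
    refine (hg.dist_le_mul x (hs (subset_closure hx)) z
      (hs (frontier_subset_closure hzΩ))).trans ?_
    gcongr
    rw [← dist_add_dist_of_mem_segment hz]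
    linarith [dist_nonneg (x := z) (y := y)]
  refine LipschitzWith.of_dist_le_mul fun x y => ?_
  by_cases hx : x ∈ Ω <;> by_cases hy : y ∈ Ω
  · simpa [hx, hy] using hg.dist_le_mul x (hs (subset_closure hx)) y (hs (subset_closure hy))
  · simpa [hx, hy] using key x hx y hy
  · simpa [hx, hy, dist_comm] using key y hy x hx
  · simp only [Set.indicator_of_notMem hx, Set.indicator_of_notMem hy, dist_self]
    positivity

variable [FiniteDimensional ℝ E] [MeasurableSpace E] [BorelSpace E] (μ : Measure E)
  [μ.IsAddHaarMeasure]

/-- Apply Rademacher to `‖G‖`: a zero of `G` is a minimum of `‖G‖`, so the derivative there vanishes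
and `G` itself is `o(‖y - x‖)`. -/
theorem LipschitzWith.ae_hasFDerivAt_zero {G : E → ℝ} {C : NNReal} (hG : LipschitzWith C G) :
    ∀ᵐ x ∂μ, G x = 0 → HasFDerivAt G (0 : E →L[ℝ] ℝ) x := by
  have hn : LipschitzWith (1 * C) fun x => ‖G x‖ := lipschitzWith_one_norm.comp hG
  filter_upwards [hn.ae_differentiableAt (μ := μ)] with x hx h0
  have hmin : IsLocalMin (fun x => ‖G x‖) x := Filter.Eventually.of_forall fun y => by simp [h0]
  have h := hx.hasFDerivAt
  rw [hmin.fderiv_eq_zero] at h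
  rw [hasFDerivAt_iff_isLittleO] at h ⊢
  simpa [h0] using h

theorem LipschitzWith.integral_lineDeriv_eq_zero {G : E → ℝ} {C : NNReal} (hG : LipschitzWith C G)
    (hc : HasCompactSupport G) (v : E) : ∫ x, lineDeriv ℝ G x v ∂μ = 0 := by
  -- Integration by parts against the constant `1`; the formula flips the direction, hence `-v`.
  have h := LipschitzWith.integral_lineDeriv_mul_eq (μ := μ)
    (LipschitzWith.const (1 : ℝ) : LipschitzWith 0 fun _ : E => (1 : ℝ)) hG hc (-v)
  simpa [lineDeriv] using h.symm

/-- The extension of `g` by zero is Lipschitz with compact support, so its derivative integrates to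
zero. The frontier may have positive measure: almost everywhere off `Ω` the derivative of the
extension is zero. -/
theorem setIntegral_fderiv_eq_zero_of_real {Ω : Set E} (hΩ : IsOpen Ω) (hb : Bornology.IsBounded Ω)
    {g : E → ℝ} (hg : ContDiff ℝ 1 g) (h0 : ∀ x ∈ frontier Ω, g x = 0) (v : E) :
    ∫ x in Ω, fderiv ℝ g x v ∂μ = 0 := by
  obtain ⟨r, hr⟩ := hb.subset_closedBall (0 : E)
  -- A ball replaces `closure Ω` because the Lipschitz bound needs a convex set.
  obtain ⟨C, hC⟩ := hg.contDiffOn.exists_lipschitzOnWith one_ne_zero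
    (convex_closedBall (0 : E) r) (isCompact_closedBall (0 : E) r)
  have hcl : closure Ω ⊆ Metric.closedBall (0 : E) r :=
    closure_minimal hr Metric.isClosed_closedBall
  have hL := hC.lipschitzWith_indicator hcl h0
  have hc : HasCompactSupport (Ω.indicator g) :=
    HasCompactSupport.intro (isCompact_closedBall (0 : E) r) fun x hx =>
      Set.indicator_of_notMem (fun h => hx (hr h)) g
  rw [← integral_indicator hΩ.measurableSet, ← hL.integral_lineDeriv_eq_zero μ hc v]
  refine integral_congr_ae ?_
  filter_upwards [hL.ae_hasFDerivAt_zero μ] with x hx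
  by_cases hxΩ : x ∈ Ω
  · have he : Ω.indicator g =ᶠ[nhds x] g :=
      Filter.eventuallyEq_of_mem (hΩ.mem_nhds hxΩ) fun y hy => Set.indicator_of_mem hy g
    have hd : HasFDerivAt (Ω.indicator g) (fderiv ℝ g x) x :=
      (hg.differentiable one_ne_zero x).hasFDerivAt.congr_of_eventuallyEq he
    rw [Set.indicator_of_mem hxΩ, (hd.hasLineDerivAt v).lineDeriv]
  · rw [Set.indicator_of_notMem hxΩ,
      ((hx (Set.indicator_of_notMem hxΩ g)).hasLineDerivAt v).lineDeriv]
    simp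

theorem setIntegral_fderiv_eq_zero {Ω : Set E} (hΩ : IsOpen Ω) (hb : Bornology.IsBounded Ω)
    {g : E → ℂ} (hg : ContDiff ℝ 1 g) (h0 : ∀ x ∈ frontier Ω, g x = 0) (v : E) :
    ∫ x in Ω, fderiv ℝ g x v ∂μ = 0 := by
  have hint : IntegrableOn (fun x => fderiv ℝ g x v) Ω μ :=
    (((hg.continuous_fderiv one_ne_zero).clm_apply continuous_const).continuousOn.integrableOn_compact
      hb.isCompact_closure).mono_set subset_closure
  have key : ∀ L : ℂ →L[ℝ] ℝ, L (∫ x in Ω, fderiv ℝ g x v ∂μ) = 0 := by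
    intro L
    rw [← L.integral_comp_comm hint, ← setIntegral_fderiv_eq_zero_of_real μ hΩ hb
      (L.contDiff.comp hg) (fun x hx => by simp [h0 x hx]) v]
    congr 1 with x
    have := (L.hasFDerivAt.comp x (hg.differentiable one_ne_zero x).hasFDerivAt).fderiv
    rw [this]
    rfl
  exact Complex.ext (key Complex.reCLM) (key Complex.imCLM)

end Boundary

namespace HankelSLRM

/-! ### Fourier transforms of distributions that are functions -/

theorem IsFourierFun.sub {S T : 𝓢'(Plane, ℂ)} {g h : Plane → ℂ} (hS : IsFourierFun S g)
    (hT : IsFourierFun T h) : IsFourierFun (S - T) (fun ξ => g ξ - h ξ) := by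
  refine ⟨hS.1.sub hT.1, fun f => ?_⟩
  simp only [mul_sub]
  refine ⟨(hS.2 f).1.sub (hT.2 f).1, ?_⟩
  rw [integral_sub (hS.2 f).1 (hT.2 f).1, ← (hS.2 f).2, ← (hT.2 f).2]
  rfl

theorem IsFourierFun.add {S T : 𝓢'(Plane, ℂ)} {g h : Plane → ℂ} (hS : IsFourierFun S g)
    (hT : IsFourierFun T h) : IsFourierFun (S + T) (fun ξ => g ξ + h ξ) := by
  refine ⟨hS.1.add hT.1, fun f => ?_⟩
  simp only [mul_add]
  refine ⟨(hS.2 f).1.add (hT.2 f).1, ?_⟩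
  rw [integral_add (hS.2 f).1 (hT.2 f).1, ← (hS.2 f).2, ← (hT.2 f).2]
  rfl

theorem IsFourierFun.const_smul {T : 𝓢'(Plane, ℂ)} {g : Plane → ℂ} (hT : IsFourierFun T g)
    (c : ℂ) : IsFourierFun (c • T) (fun ξ => c * g ξ) := by
  refine ⟨hT.1.const_mul c, fun f => ?_⟩
  simp only [mul_left_comm _ c]
  refine ⟨(hT.2 f).1.const_mul c, ?_⟩
  rw [integral_const_mul, ← (hT.2 f).2]
  rfl

theorem IsFourierFun.partialD {T : 𝓢'(Plane, ℂ)} {g : Plane → ℂ} (hT : IsFourierFun T g)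
    (i : Fin 2) : IsFourierFun (partialD i T) (fun ξ => 2 * Real.pi * Complex.I * ξ i * g ξ) := by
  refine ⟨by have := hT.1; fun_prop, fun f => ?_⟩
  set m : Plane := EuclideanSpace.single i (1 : ℝ) with hm
  have htg : (fun ξ : Plane => ((inner ℝ ξ m : ℝ) : ℂ)).HasTemperateGrowth := by fun_prop
  have hval : ∀ ξ, (SchwartzMap.smulLeftCLM ℂ (fun ξ : Plane => ((inner ℝ ξ m : ℝ) : ℂ)) f) ξ * g ξ
      = ξ i * f ξ * g ξ := by
    intro ξ
    rw [SchwartzMap.smulLeftCLM_apply_apply htg]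
    simp [hm, EuclideanSpace.inner_single_right]
  -- The test function absorbs the factor `ξ i`, so no growth bound on `g` is required.
  obtain ⟨h1, h2⟩ := hT.2 (SchwartzMap.smulLeftCLM ℂ (fun ξ : Plane => ((inner ℝ ξ m : ℝ) : ℂ)) f)
  simp only [hval] at h1 h2
  have hfun : (fun ξ : Plane => f ξ * (2 * Real.pi * Complex.I * ξ i * g ξ))
      = fun ξ => (2 * Real.pi * Complex.I) * (ξ i * f ξ * g ξ) := by
    ext ξ; ring
  rw [hfun]
  refine ⟨h1.const_mul _, ?_⟩
  rw [integral_const_mul, ← h2, HankelSLRM.partialD, TemperedDistribution.fourier_lineDerivOp_eq]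
  rfl

theorem isFourierFun_toLp {f : Plane → ℂ} (hf : MemLp f 1 (volume : Measure Plane)) :
    IsFourierFun ((hf.toLp f : Lp ℂ 1 (volume : Measure Plane)) : 𝓢'(Plane, ℂ)) (𝓕 f) := by
  have hint : Integrable f := memLp_one_iff_integrable.mp hf
  have hcont : Continuous (𝓕 f) := VectorFourier.fourierIntegral_continuous
    Real.continuous_fourierChar (L := innerₗ Plane) continuous_inner hint
  have hbd : ∀ ξ, ‖𝓕 f ξ‖ ≤ ∫ x, ‖f x‖ :=
    VectorFourier.norm_fourierIntegral_le_integral_norm Real.fourierChar volume (innerₗ Plane) f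
  refine ⟨hcont, fun h => ⟨?_, ?_⟩⟩
  · exact h.integrable.mul_bdd hcont.aestronglyMeasurable (Filter.Eventually.of_forall hbd)
  · rw [TemperedDistribution.fourier_apply, Lp.toTemperedDistribution_apply]
    have h1 : ∫ x, (𝓕 h) x • (hf.toLp f) x = ∫ x, 𝓕 (h : Plane → ℂ) x * f x := by
      refine integral_congr_ae ?_
      filter_upwards [hf.coeFn_toLp] with x hx
      rw [hx, smul_eq_mul, SchwartzMap.fourier_coe]
    rw [h1]
    simpa using! VectorFourier.integral_fourierIntegral_smul_eq_flip (L := innerₗ Plane)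
      Real.continuous_fourierChar continuous_inner h.integrable hint

/-! ### Plane waves and the annihilation relation -/

/-- The plane wave `x ↦ exp(-2πi η · x)` of frequency `η`. -/
def wave (η x : Plane) : ℂ :=
  Complex.exp (-2 * Real.pi * Complex.I * ∑ i, (η i : ℂ) * (x i : ℂ))

theorem wave_add (η ζ x : Plane) : wave (η + ζ) x = wave η x * wave ζ x := by
  simp only [wave, ← Complex.exp_add, ← mul_add, ← Finset.sum_add_distrib, ← add_mul]
  simp

theorem contDiff_wave (η : Plane) : ContDiff ℝ 1 (wave η) := by
  have h : ∀ i : Fin 2, ContDiff ℝ 1 fun x : Plane => (x i : ℂ) := fun i =>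
    Complex.ofRealCLM.contDiff.comp (EuclideanSpace.proj (𝕜 := ℝ) i).contDiff
  unfold wave
  fun_prop

theorem fderiv_wave (η x : Plane) (i : Fin 2) :
    fderiv ℝ (wave η) x (EuclideanSpace.single i 1)
      = -(2 * Real.pi * Complex.I * η i * wave η x) := by
  have h : ∀ l : Fin 2, HasFDerivAt (fun x : Plane => (x l : ℂ))
      (Complex.ofRealCLM ∘L (EuclideanSpace.proj (𝕜 := ℝ) l : Plane →L[ℝ] ℝ)) x := fun l =>
    (Complex.ofRealCLM ∘L (EuclideanSpace.proj (𝕜 := ℝ) l : Plane →L[ℝ] ℝ)).hasFDerivAt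
  have h2 := ((HasFDerivAt.fun_sum (u := Finset.univ)
    fun l _ => (h l).const_mul (η l : ℂ)).const_mul (-2 * Real.pi * Complex.I)).cexp
  rw [show wave η = fun x => Complex.exp (-2 * Real.pi * Complex.I *
    ∑ i, (η i : ℂ) * (x i : ℂ)) from rfl, h2.fderiv]
  fin_cases i <;> simp <;> ring

theorem trigPoly_mul_wave (a : Idx →₀ ℂ) (ξ x : Plane) :
    trigPoly a x * wave ξ x = a.sum fun k c => c * wave (ξ + toPlane k) x := by
  rw [trigPoly, Finsupp.sum, Finsupp.sum, Finset.sum_mul]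
  refine Finset.sum_congr rfl fun k _ => ?_
  rw [wave_add, mul_assoc, mul_comm (wave ξ x)]
  simp [wave, toPlane]

theorem fourier_indicator {Ω : Set Plane} (hΩ : MeasurableSet Ω) (f : Plane → ℂ) (η : Plane) :
    𝓕 (Ω.indicator f) η = ∫ x in Ω, wave η x * f x := by
  rw [Real.fourier_eq', ← integral_indicator hΩ]
  congr 1 with x
  by_cases hx : x ∈ Ω
  · rw [Set.indicator_of_mem hx, Set.indicator_of_mem hx, smul_eq_mul, wave]
    congr 2
    simp [PiLp.inner_apply, Fin.sum_univ_two]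
    ring
  · rw [Set.indicator_of_notMem hx, Set.indicator_of_notMem hx, smul_zero]

/-- The filter `a` annihilates all the sequences of shifted samples of `g`. -/
def Annihilates (a : Idx →₀ ℂ) (g : Plane → ℂ) : Prop :=
  ∀ ξ, (a.sum fun m c => c * g (ξ + toPlane m)) = 0

theorem Annihilates.sum {ι : Type*} {s : Finset ι} {a : Idx →₀ ℂ} {g : ι → Plane → ℂ}
    (h : ∀ j ∈ s, Annihilates a (g j)) : Annihilates a (fun ξ => ∑ j ∈ s, g j ξ) := by
  intro ξ
  simp only [Finsupp.sum, Finset.mul_sum]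
  rw [Finset.sum_comm]
  exact Finset.sum_eq_zero fun j hj => h j hj ξ

theorem Annihilates.add {a : Idx →₀ ℂ} {g h : Plane → ℂ} (hg : Annihilates a g)
    (hh : Annihilates a h) : Annihilates a (fun ξ => g ξ + h ξ) := by
  intro ξ
  have h1 := hg ξ
  have h2 := hh ξ
  simp only [Finsupp.sum] at h1 h2 ⊢
  simp only [mul_add, Finset.sum_add_distrib, h1, h2, add_zero]

theorem Annihilates.const_mul {a : Idx →₀ ℂ} {g : Plane → ℂ} (hg : Annihilates a g)
    (z : ℂ) : Annihilates a (fun ξ => z * g ξ) := by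
  intro ξ
  have h1 := hg ξ
  simp only [Finsupp.sum] at h1 ⊢
  simp only [mul_left_comm _ z, ← Finset.mul_sum, h1, mul_zero]

/-- With `d` the constant value of `∂ᵢ f`, each `∂ᵢ(wave η · f)` integrates over `Ω` to minus the
annihilated function at `η`. The factor `φ` removes the boundary contribution. -/
theorem annihilates_of_frontier_subset {Ω : Set Plane} (hΩ : IsOpen Ω)
    (hb : Bornology.IsBounded Ω) {a : Idx →₀ ℂ} (ha : frontier Ω ⊆ {x | trigPoly a x = 0})
    {f : Plane → ℂ} (hf : ContDiff ℝ 1 f) {d : ℂ} (i : Fin 2)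
    (hd : ∀ x, fderiv ℝ f x (EuclideanSpace.single i 1) = d) :
    Annihilates a fun ξ => 2 * Real.pi * Complex.I * ξ i * 𝓕 (Ω.indicator f) ξ
      - 𝓕 (Ω.indicator fun _ => d) ξ := by
  intro ξ
  have hg : ∀ η, ContDiff ℝ 1 fun x => wave η x * f x := fun η => (contDiff_wave η).mul hf
  have hsum : (fun x => trigPoly a x * wave ξ x * f x)
      = fun x => ∑ m ∈ a.support, a m * (wave (ξ + toPlane m) x * f x) := by
    ext x
    simp only [trigPoly_mul_wave, Finsupp.sum, Finset.sum_mul, mul_assoc]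
  have hG : ContDiff ℝ 1 fun x => trigPoly a x * wave ξ x * f x := by
    rw [hsum]
    exact ContDiff.sum fun m _ => contDiff_const.mul (hg _)
  have hint : ∀ {h : Plane → ℂ}, Continuous h → IntegrableOn h Ω := fun hh =>
    (hh.continuousOn.integrableOn_compact hb.isCompact_closure).mono_set subset_closure
  have h0 := setIntegral_fderiv_eq_zero volume hΩ hb hG
    (fun x hx => by rw [show trigPoly a x = 0 from ha hx, zero_mul, zero_mul])
    (EuclideanSpace.single i 1)
  have hder : ∀ η x, fderiv ℝ (fun x => wave η x * f x) x (EuclideanSpace.single i 1)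
      = wave η x * d - 2 * Real.pi * Complex.I * η i * (wave η x * f x) := by
    intro η x
    rw [fderiv_fun_mul ((contDiff_wave η).differentiable one_ne_zero x)
      (hf.differentiable one_ne_zero x)]
    simp only [add_apply, smul_apply, hd, fderiv_wave,
      smul_eq_mul]
    ring
  have hder' : ∀ x, fderiv ℝ (fun x => trigPoly a x * wave ξ x * f x) x
        (EuclideanSpace.single i 1)
      = ∑ m ∈ a.support, a m * (wave (ξ + toPlane m) x * d -
        2 * Real.pi * Complex.I * (ξ + toPlane m) i * (wave (ξ + toPlane m) x * f x)) := by
    intro x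
    rw [hsum, fderiv_fun_sum fun m _ =>
      (contDiff_const.mul (hg _)).differentiable one_ne_zero x]
    simp only [sum_apply]
    refine Finset.sum_congr rfl fun m _ => ?_
    rw [fderiv_const_mul ((hg _).differentiable one_ne_zero x), smul_apply,
      hder, smul_eq_mul]
  have hw : ∀ η, Continuous (wave η) := fun η => (contDiff_wave η).continuous
  have hfc := hf.continuous
  simp only [hder'] at h0
  rw [integral_finsetSum _ fun m _ => hint (by have := hw (ξ + toPlane m); fun_prop)] at h0
  rw [← neg_eq_zero, ← h0, Finsupp.sum, ← Finset.sum_neg_distrib]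
  refine Finset.sum_congr rfl fun m _ => ?_
  have := hw (ξ + toPlane m)
  rw [integral_const_mul, integral_sub (hint (by fun_prop)) (hint (by fun_prop)),
    integral_const_mul]
  simp only [fourier_indicator hΩ.measurableSet]
  ring

/-! ### Null space of Hankel matrices -/

/-- The sum is the coefficient at `m` of a product in the group algebra of `ℤ²`, which has no zero
divisors. -/
theorem eq_zero_of_sum_shift_eq_zero {a : Idx →₀ ℂ} (ha : a ≠ 0) {s : Finset Idx} {c : s → ℂ}
    (h : ∀ m, ∑ l, c l * a (-l.1 + m) = 0) : c = 0 := by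
  set P : AddMonoidAlgebra ℂ Idx := ∑ l : s, AddMonoidAlgebra.single l.1 (c l) with hP
  have hA : (AddMonoidAlgebra.ofCoeff a : AddMonoidAlgebra ℂ Idx) ≠ 0 := fun h0 =>
    ha (congrArg AddMonoidAlgebra.coeff h0)
  have hPA : P * AddMonoidAlgebra.ofCoeff a = 0 := by
    refine AddMonoidAlgebra.coeff_injective (Finsupp.ext fun m => ?_)
    rw [hP, Finset.sum_mul, AddMonoidAlgebra.coeff_sum, Finsupp.finsetSum_apply]
    simpa using h m
  have hP0 : P = 0 := (mul_eq_zero.mp hPA).resolve_right hA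
  ext l
  have hl := DFunLike.congr_fun (congrArg AddMonoidAlgebra.coeff hP0) l.1
  rw [hP, AddMonoidAlgebra.coeff_sum, Finsupp.finsetSum_apply] at hl
  simpa [Finsupp.single_apply] using hl

theorem toPlane_add (k l : Idx) : toPlane (k + l) = toPlane k + toPlane l := by
  ext i
  simp [toPlane]

/-- The additive form ensures that no truncated subtraction weakens the bound. -/
theorem rank_multiHankel_add_card_colon_le {ι : Type} [Fintype ι] (O K K' : Finset Idx)
    {a : Idx →₀ ℂ} (ha : a ≠ 0) (haK : a.support ⊆ K) {g : ι → Plane → ℂ}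
    (hg : ∀ c, Annihilates a (g c)) :
    (multiHankel O K' (samples O g)).rank + (colon K' K).card ≤ K'.card := by
  -- Combinations of the translates of `a` by `l ∈ colon K' K`; these are supported in `K'`, so
  -- restricting to `K'` loses nothing.
  let Φ : (colon K' K → ℂ) →ₗ[ℂ] (K' → ℂ) :=
    { toFun := fun c m => ∑ l, c l * a (-l.1 + m.1)
      map_add' := fun c d => by
        ext m; simp [add_mul, Finset.sum_add_distrib]
      map_smul' := fun z c => by
        ext m; simp [Finset.mul_sum, mul_assoc] }
  have hmem : ∀ l ∈ colon K' K, ∀ m, a (-l + m) ≠ 0 → m ∈ K' := fun l hl m hm => by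
    simpa using add_mem_of_mem_colon hl (haK (Finsupp.mem_support_iff.mpr hm))
  have hinj : LinearMap.ker Φ = ⊥ := by
    refine LinearMap.ker_eq_bot'.mpr fun c hc => eq_zero_of_sum_shift_eq_zero ha fun m => ?_
    by_cases hm : m ∈ K'
    · exact congrFun hc ⟨m, hm⟩
    · refine Finset.sum_eq_zero fun l _ => ?_
      rw [not_not.mp (mt (hmem l.1 l.2 m) hm), mul_zero]
  have hle : LinearMap.range Φ ≤ LinearMap.ker (multiHankel O K' (samples O g)).mulVecLin := by
    rintro _ ⟨c, rfl⟩
    rw [LinearMap.mem_ker, Matrix.mulVecLin_apply]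
    ext ⟨i, k, hk⟩
    -- Row `k` against the translate by `l` is the annihilation relation at frequency `k + l`,
    -- reindexed by `m ↦ l + m`.
    have hrow : ∀ l : colon K' K,
        ∑ m : K', g i (toPlane (k + m.1)) * a (-l.1 + m.1) = 0 := by
      intro l
      rw [← hg i (toPlane (k + l.1)), Finsupp.sum,
        Finset.sum_coe_sort K' fun m => g i (toPlane (k + m)) * a (-l.1 + m)]
      symm
      refine Finset.sum_of_injOn (fun m => l.1 + m) (fun x _ y _ h => add_left_cancel h)
        (fun m hm => add_mem_of_mem_colon l.2 (haK hm)) (fun m _ hm' => ?_) (fun m _ => ?_)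
      · by_contra hne
        refine hm' ⟨-l.1 + m, ?_, by simp⟩
        exact Finsupp.mem_support_iff.mpr fun h0 => hne (by rw [h0, mul_zero])
      · simp [toPlane_add, add_assoc, mul_comm]
    simp only [Matrix.mulVec, dotProduct, multiHankel, Matrix.of_apply, samples, Φ,
      LinearMap.coe_mk, AddHom.coe_mk, Finset.mul_sum, Pi.zero_apply]
    rw [Finset.sum_comm]
    refine Finset.sum_eq_zero fun l _ => ?_
    simp only [mul_left_comm _ (c l), ← Finset.mul_sum, hrow l, mul_zero]
  have h1 := LinearMap.finrank_range_add_finrank_ker (multiHankel O K' (samples O g)).mulVecLin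
  have h2 := Submodule.finrank_mono hle
  rw [LinearMap.finrank_range_of_inj (LinearMap.ker_eq_bot.mp hinj)] at h2
  simp only [Module.finrank_fintype_fun_eq_card, Fintype.card_coe] at h1 h2
  rw [Matrix.rank]
  omega

theorem card_colon_symGrid_pos {n : Fin 2 → ℕ} {K' : Finset Idx} (h : symGrid n ⊆ K') :
    0 < (colon K' (symGrid n)).card := by
  -- The zero shift is admissible; this makes the rank bound strict.
  refine Finset.card_pos.mpr ⟨0, Finset.mem_filter.mpr ⟨h ?_, fun m hm => by simpa using h hm⟩⟩
  simp [symGrid]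

/-! ### Piecewise linear images -/

theorem fourier_finsetSum {ι : Type*} (s : Finset ι) {h : ι → Plane → ℂ}
    (hh : ∀ j ∈ s, Integrable (h j)) (ξ : Plane) :
    𝓕 (fun x => ∑ j ∈ s, h j x) ξ = ∑ j ∈ s, 𝓕 (h j) ξ := by
  simp only [Real.fourier_eq, Finset.smul_sum]
  exact integral_finsetSum _ fun j hj => (Real.fourierIntegral_convergent_iff ξ).mpr (hh j hj)

namespace PiecewiseLinear

variable {J : ℕ} (D : PiecewiseLinear J)

/-- The affine function `αⱼᵀ x + βⱼ` on the `j`-th piece. -/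
def piece (j : Fin J) (x : Plane) : ℂ := (∑ i, D.α j i * (x i : ℂ)) + D.β j

theorem contDiff_piece (j : Fin J) : ContDiff ℝ 1 (D.piece j) := by
  have h : ∀ i : Fin 2, ContDiff ℝ 1 fun x : Plane => (x i : ℂ) := fun i =>
    Complex.ofRealCLM.contDiff.comp (EuclideanSpace.proj (𝕜 := ℝ) i).contDiff
  unfold piece
  fun_prop

theorem fderiv_piece (j : Fin J) (x : Plane) (i : Fin 2) :
    fderiv ℝ (D.piece j) x (EuclideanSpace.single i 1) = D.α j i := by
  have h : ∀ l : Fin 2, HasFDerivAt (fun x : Plane => (x l : ℂ))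
      (Complex.ofRealCLM ∘L (EuclideanSpace.proj (𝕜 := ℝ) l : Plane →L[ℝ] ℝ)) x := fun l =>
    (Complex.ofRealCLM ∘L (EuclideanSpace.proj (𝕜 := ℝ) l : Plane →L[ℝ] ℝ)).hasFDerivAt
  have h2 := (HasFDerivAt.fun_sum (u := Finset.univ)
    fun l _ => (h l).const_mul (D.α j l)).add_const (D.β j)
  rw [show D.piece j = fun x => (∑ i, D.α j i * (x i : ℂ)) + D.β j from rfl, h2.fderiv]
  fin_cases i <;> simp

theorem fourier_u (ξ : Plane) : 𝓕 D.u ξ = ∑ j, 𝓕 ((D.Ω j).indicator (D.piece j)) ξ :=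
  fourier_finsetSum _ (fun j _ => memLp_one_iff_integrable.mp
    (D.memLp_indicator j (D.contDiff_piece j).continuous)) ξ

theorem fourier_p (i : Fin 2) (ξ : Plane) :
    𝓕 (D.p i) ξ = ∑ j, 𝓕 ((D.Ω j).indicator fun _ => D.α j i) ξ :=
  fourier_finsetSum _ (fun j _ => memLp_one_iff_integrable.mp
    (D.memLp_indicator j continuous_const)) ξ

variable {D}

theorem annihilates_gradResidual {a : Idx →₀ ℂ} (ha : D.singSet ⊆ {x | trigPoly a x = 0})
    (i : Fin 2) :
    Annihilates a fun ξ => 2 * Real.pi * Complex.I * ξ i * 𝓕 D.u ξ - 𝓕 (D.p i) ξ := by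
  simp only [fourier_u, fourier_p, Finset.mul_sum, ← Finset.sum_sub_distrib]
  exact Annihilates.sum fun j _ => annihilates_of_frontier_subset (D.isOpen j) (D.isBounded j)
    ((Set.subset_iUnion _ j).trans ha) (D.contDiff_piece j) i fun x => D.fderiv_piece j x i

theorem annihilates_partialD_p {a : Idx →₀ ℂ} (ha : D.singSet ⊆ {x | trigPoly a x = 0})
    (i l : Fin 2) :
    Annihilates a fun ξ => 2 * Real.pi * Complex.I * ξ i * 𝓕 (D.p l) ξ := by
  simp only [fourier_p, Finset.mul_sum]
  refine Annihilates.sum fun j _ ξ => ?_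
  -- On each piece `p` is constant, so `d = 0` and the second transform drops out.
  have h := annihilates_of_frontier_subset (D.isOpen j) (D.isBounded j)
    ((Set.subset_iUnion _ j).trans ha) (f := fun _ => D.α j l) contDiff_const (d := 0) i
    (fun x => by simp) ξ
  have h0 : ∀ η, 𝓕 ((D.Ω j).indicator fun _ => (0 : ℂ)) η = 0 := fun η => by
    rw [fourier_indicator (D.isOpen j).measurableSet]
    simp
  simpa only [h0, sub_zero] using h

end PiecewiseLinear

end HankelSLRM

end

open HankelSLRM
theorem proposition1 (J : ℕ) (D : PiecewiseLinear J)
    (n : Fin 2 → ℕ) (K : Finset Idx) (hK : K = symGrid n)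
    (a : Idx →₀ ℂ) (ha : IsMinimalPoly D.singSet a) (haK : a.support ⊆ K)
    (K' : Finset Idx) (hKK' : K ⊂ K') (N : ℕ) :
    ∃ (F : Fin 2 → Plane → ℂ) (S : Fin 2 × Fin 2 → Plane → ℂ),
      (∀ i, IsFourierFun (gradResidual D i) (F i)) ∧
      (∀ c, IsFourierFun (symGrad D c) (S c)) ∧
      (multiHankel (sampleGrid N) K' (samples (sampleGrid N) F)).rank
        ≤ K'.card - (colon K' K).card ∧
      (multiHankel (sampleGrid N) K' (samples (sampleGrid N) S)).rank
        ≤ K'.card - (colon K' K).card ∧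
      (multiHankel (sampleGrid N) K' (samples (sampleGrid N) F)).rank < K'.card ∧
      (multiHankel (sampleGrid N) K' (samples (sampleGrid N) S)).rank < K'.card := by
  obtain ⟨⟨ha0, hΓ⟩, -⟩ := ha
  have hu := isFourierFun_toLp D.memLp_u
  have hp := fun i => isFourierFun_toLp (D.memLp_p i)
  set F : Fin 2 → Plane → ℂ := fun i ξ =>
    2 * Real.pi * Complex.I * ξ i * 𝓕 D.u ξ - 𝓕 (D.p i) ξ
  set S : Fin 2 × Fin 2 → Plane → ℂ := fun c ξ =>
    (1 / 2 : ℂ) * (2 * Real.pi * Complex.I * ξ c.2 * 𝓕 (D.p c.1) ξ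
      + 2 * Real.pi * Complex.I * ξ c.1 * 𝓕 (D.p c.2) ξ)
  have hF := rank_multiHankel_add_card_colon_le (sampleGrid N) K K' ha0 haK (g := F)
    fun i => PiecewiseLinear.annihilates_gradResidual hΓ i
  have hS := rank_multiHankel_add_card_colon_le (sampleGrid N) K K' ha0 haK (g := S)
    fun c => ((PiecewiseLinear.annihilates_partialD_p hΓ c.2 c.1).add
      (PiecewiseLinear.annihilates_partialD_p hΓ c.1 c.2)).const_mul _
  have hpos : 0 < (colon K' K).card := by
    subst hK
    exact card_colon_symGrid_pos hKK'.subset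
  exact ⟨F, S, fun i => (hu.partialD i).sub (hp i),
    fun c => (((hp c.1).partialD c.2).add ((hp c.2).partialD c.1)).const_smul _,
    by omega, by omega, by omega, by omega⟩
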